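/- Let $S$ be a finite non-empty set and let $\mu\colon\mathcal P(S)\to\mathbf Z$ be submodular, i.e. $\mu(A)+\mu(B)\ge\mu(A\cup B)+\mu(A\cap B)$ for all $A,B\subseteq S$, and non-decreasing, i.e. $\mu(A)\le\mu(B)$ whenever $A\subseteq B\subseteq S$. Let $$P_\mu=\Big\{x\in\mathbf R^S : x\ge 0,\ \sum_{s\in U}x_s\le\mu(U)\text{ for all }U\subseteq S\Big\},\qquad B_\mu=\Big\{x\in P_\mu : \sum_{s\in S}x_s=\mu(S)\Big\}$$ be the associated polymatroid and its base polytope. Let $\mathbf i_s$ ($s\in S$) be the standard basis vectors of $\mathbf R^S$, $\Delta_S=\mathrm{conv}\{\mathbf i_s : s\in S\}$ and $\nabla_S=\mathrm{conv}\{-\mathbf i_s : s\in S\}$. Fix a linear order on $S$. For $f\in B_\mu\cap\mathbf Z^S$, an element $e\in S$ is internally active if there is no $e'<e$ with $f-\mathbf i_e+\mathbf i_{e'}\in B_\mu$, and externally active if there is no $e'<e$ with $f+\mathbf i_e-\mathbf i_{e'}\in B_\mu$. Let $\bar\iota(f)$ and $\bar\varepsilon(f)$ be the numbers of elements of $S$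 that are not internally active and not externally active, respectively, and let $$I_\mu(x)=\sum_{f\in B_\mu\cap\mathbf Z^S}x^{\bar\iota(f)},\qquad X_\mu(x)=\sum_{f\in B_\mu\cap\mathbf Z^S}x^{\bar\varepsilon(f)}$$ be the interior and the exterior polynomial of $\mu$. Then $I_\mu$ and $X_\mu$ have degree at most $|S|-1$, the (finite) numbers of lattice points $$\left|(B_\mu+k\nabla_S)\cap\mathbf Z^S\right|\quad\text{and}\quad\left|(B_\mu+k\Delta_S)\cap\mathbf Z^S\right|\qquad(k=0,1,2,\dots)$$ are polynomials in $k$, and the coefficients of $I_\mu$ (resp. $X_\mu$) in the basis $1,x,x^2,\dots,x^{|S|-1}$ are equal to the coefficients of the first (resp. second) of these polynomials in the basis $\binom{k+|S|-1}{|S|-1},\dots,\binom{k+2}{2},k+1,1$, in this order. In particular, $I_\mu$ and $X_\mu$ do not depend on the linear order on $S$. -/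

import Mathlib

open Polynomial
open scoped Pointwise

noncomputable section

/-- The polymatroid `P_μ ⊆ ℝ^S`: nonnegative vectors `x` with `∑_{s ∈ U} x s ≤ μ U` for all `U`. -/
def polymatroid {S : Type*} (μ : Finset S → ℤ) : Set (S → ℝ) :=
  {x | (∀ s, 0 ≤ x s) ∧ ∀ U : Finset S, ∑ s ∈ U, x s ≤ (μ U : ℝ)}

/-- The base polytope `B_μ` of the polymatroid `P_μ`. -/
def basePolytope {S : Type*} [Fintype S] (μ : Finset S → ℤ) : Set (S → ℝ) :=
  {x | x ∈ polymatroid μ ∧ ∑ s, x s = (μ Finset.univ : ℝ)}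

/-- The inverted standard simplex `∇_S`; the standard simplex `Δ_S` is Mathlib's `stdSimplex ℝ S`. -/
def invertedSimplex (S : Type*) [DecidableEq S] : Set (S → ℝ) :=
  convexHull ℝ (Set.range fun s : S => -(Pi.single s 1 : S → ℝ))

/-- The lattice points `A ∩ ℤ^S` of a set `A ⊆ ℝ^S`, as integer vectors. -/
def latticePoints {S : Type*} (A : Set (S → ℝ)) : Set (S → ℤ) :=
  {z | (fun s => (z s : ℝ)) ∈ A}

theorem latticePoints_basePolytope_finite {S : Type*} [Fintype S] (μ : Finset S → ℤ) :
    (latticePoints (basePolytope μ)).Finite := by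
  classical
  refine (Set.finite_Icc (0 : S → ℤ) (fun s => μ {s})).subset ?_
  rintro z ⟨⟨h0, hU⟩, -⟩
  refine ⟨fun s => ?_, fun s => ?_⟩
  · have := h0 s
    simpa using this
  · have := hU {s}
    simpa using this

/-- The integer points of the base polytope (the generalization of hypertrees). -/
def integerBases {S : Type*} [Fintype S] (μ : Finset S → ℤ) : Finset (S → ℤ) :=
  (latticePoints_basePolytope_finite μ).toFinset

/-- The vector obtained from `f` by decreasing `f e` by `1` and increasing `f e'` by `1`. -/
def transfer {S : Type*} [DecidableEq S] (f : S → ℤ) (e e' : S) : S → ℤ :=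
  f - Pi.single e 1 + Pi.single e' 1

/-- `e` is internally active at `f` with respect to the order `o`: no transfer from `e` to a smaller
element results in an integer base. -/
def InternallyActive {S : Type*} [Fintype S] [DecidableEq S] (μ : Finset S → ℤ)
    (o : LinearOrder S) (f : S → ℤ) (e : S) : Prop :=
  ∀ e' : S, o.lt e' e → transfer f e e' ∉ integerBases μ

/-- `e` is externally active at `f` with respect to the order `o`: no transfer to `e` from a smaller
element results in an integer base. -/
def ExternallyActive {S : Type*} [Fintype S] [DecidableEq S] (μ : Finset S → ℤ)
    (o : LinearOrder S) (f : S → ℤ) (e : S) : Prop :=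
  ∀ e' : S, o.lt e' e → transfer f e' e ∉ integerBases μ

open scoped Classical in
/-- The number of internally inactive elements. -/
def internalInactivity {S : Type*} [Fintype S] [DecidableEq S] (μ : Finset S → ℤ)
    (o : LinearOrder S) (f : S → ℤ) : ℕ :=
  (Finset.univ.filter fun e => ¬ InternallyActive μ o f e).card

open scoped Classical in
/-- The number of externally inactive elements. -/
def externalInactivity {S : Type*} [Fintype S] [DecidableEq S] (μ : Finset S → ℤ)
    (o : LinearOrder S) (f : S → ℤ) : ℕ :=
  (Finset.univ.filter fun e => ¬ ExternallyActive μ o f e).card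

/-- The interior polynomial `I_μ`, computed with the order `o`. -/
def interiorPolynomial {S : Type*} [Fintype S] [DecidableEq S] (μ : Finset S → ℤ)
    (o : LinearOrder S) : ℤ[X] :=
  ∑ f ∈ integerBases μ, X ^ internalInactivity μ o f

/-- The exterior polynomial `X_μ`, computed with the order `o`. -/
def exteriorPolynomial {S : Type*} [Fintype S] [DecidableEq S] (μ : Finset S → ℤ)
    (o : LinearOrder S) : ℤ[X] :=
  ∑ f ∈ integerBases μ, X ^ externalInactivity μ o f

/-- The polynomial `(k + d choose d)` in the variable `k`. -/
def binomPoly (d : ℕ) : ℚ[X] := preHilbertPoly ℚ d 0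

theorem binomPoly_eval (d k : ℕ) : (binomPoly d).eval (k : ℚ) = ((k + d).choose d : ℚ) := by
  simpa [binomPoly] using preHilbertPoly_eq_choose_sub_add ℚ d (Nat.zero_le k)

end

/-! Let `B` be the set of integer bases. A submodular integrality argument
(`exists_integerBase_between`) shows that the lattice points of `B_μ + kΔ_S` are the vectors `f + h`
with `f ∈ B` and `h ≥ 0` integral of total `k`. Such a `g` has several decompositions, but exactly
one with `h` supported on the externally active elements of `f`: the one where `f` is the
lexicographically least base below `g`. Minimality gives existence, and the exchange property gives
uniqueness.

Counting the `h` for each `f` by stars and bars gives `∑_f (k + d choose d)` with `d = |S| - 1 -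
ε̄(f)`, which is the claim for `X_μ`. The count does not involve the order, so neither does `X_μ`,
by linear independence of the binomial basis. The claim for `I_μ` is the same argument applied to
`-B`. -/

/-- Stars and bars for functions supported in a finite set. -/
theorem card_piAntidiag_nat {S : Type*} [DecidableEq S] (s : Finset S) (k : ℕ) :
    (Finset.piAntidiag s k).card = (s.card + k - 1).choose k := by
  rw [← Finset.card_finsuppAntidiag_nat_eq_choose]
  simp [Finset.finsuppAntidiag]

/-! ### Unique decompositions in sets with the exchange property -/

/-- The exchange property of a finite set `B` of integer vectors. -/
def HasExchange {S : Type*} [DecidableEq S] (B : Finset (S → ℤ)) : Prop :=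
  ∀ f ∈ B, ∀ g ∈ B, ∀ i, g i < f i → ∃ j, f j < g j ∧ transfer f i j ∈ B

open scoped Classical in
/-- The elements which cannot be increased at `f` at the expense of a smaller element without
leaving `B`. -/
def activeElements {S : Type*} [Fintype S] [DecidableEq S] (B : Finset (S → ℤ))
    (o : LinearOrder S) (f : S → ℤ) : Finset S :=
  Finset.univ.filter fun e => ∀ e', o.lt e' e → transfer f e' e ∉ B

/-- The vectors obtained from `B` by adding nonnegative integer vectors of total `k`. -/
def upperShift {S : Type*} [Fintype S] (B : Finset (S → ℤ)) (k : ℕ) : Set (S → ℤ) :=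
  {g | ∃ f ∈ B, ∃ h : S → ℕ, ∑ s, h s = k ∧ g = fun s => f s + (h s : ℤ)}

theorem transfer_apply {S : Type*} [DecidableEq S] (f : S → ℤ) (e e' s : S) :
    transfer f e e' s = f s - (if s = e then 1 else 0) + (if s = e' then 1 else 0) := by
  simp [transfer, Pi.single_apply]

section

variable {S : Type*} [Fintype S] [DecidableEq S] {B : Finset (S → ℤ)} (o : LinearOrder S)

/-- The lexicographically least `f ∈ B` below `g` works: if `f e < g e` and `e` were inactive, a
transfer to `e` from a smaller element would stay below `g` and be lexicographically smaller. -/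
theorem exists_sub_supported_on_activeElements {g f₀ : S → ℤ} (hf₀ : f₀ ∈ B) (h₀ : f₀ ≤ g) :
    ∃ f ∈ B, f ≤ g ∧ ∀ s, f s < g s → s ∈ activeElements B o f := by
  classical
  let := o
  obtain ⟨f, hf, hmin⟩ := Finset.exists_min_image (B.filter (· ≤ g)) (fun f => toLex f)
    ⟨f₀, by simp [hf₀, h₀]⟩
  rw [Finset.mem_filter] at hf
  refine ⟨f, hf.1, hf.2, fun e he => ?_⟩
  simp only [activeElements, Finset.mem_filter, Finset.mem_univ, true_and]
  intro e' hlt hmem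
  have hne : e' ≠ e := ne_of_lt hlt
  have hle : transfer f e' e ≤ g := by
    intro s
    have := hf.2 s
    rw [transfer_apply]
    by_cases h1 : s = e
    · subst h1; simp [hne.symm]; omega
    · simp only [h1, if_false]
      have : f s ≤ g s := this
      split_ifs <;> omega
  refine absurd (hmin _ (Finset.mem_filter.2 ⟨hmem, hle⟩)) (not_le.2 ?_)
  refine ⟨e', fun j hj => ?_, ?_⟩
  · have h2 : j ≠ e' := ne_of_lt hj
    have h3 : j ≠ e := ne_of_lt (lt_trans hj hlt)
    change transfer f e' e j = f j
    simp [transfer_apply, h2, h3]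
  · change transfer f e' e e' < f e'
    simp [transfer_apply, hne]

/-- The support condition forces `f` to be lexicographically least below `g`. If `f'` is smaller and
first differs from `f` at `i`, exchange yields a `j` with `f j < f' j ≤ g j`; agreement before `i`
gives `i < j`, so `j` is inactive although `f j < g j`. -/
theorem eq_of_sub_supported_on_activeElements (hB : HasExchange B) {g f₁ f₂ : S → ℤ}
    (h₁ : f₁ ∈ B) (h₂ : f₂ ∈ B) (hg₁ : f₁ ≤ g) (hg₂ : f₂ ≤ g)
    (ha₁ : ∀ s, f₁ s < g s → s ∈ activeElements B o f₁)
    (ha₂ : ∀ s, f₂ s < g s → s ∈ activeElements B o f₂) : f₁ = f₂ := by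
  let := o
  have key : ∀ f ∈ B, ∀ f' ∈ B, f' ≤ g → (∀ s, f s < g s → s ∈ activeElements B o f) →
      ¬ toLex f' < toLex f := by
    rintro f hf f' hf' hg' ha ⟨i, hlt, hi⟩
    obtain ⟨j, hj, hmem⟩ := hB f hf f' hf' i hi
    have hij : i < j := by
      rcases lt_trichotomy i j with h | h | h
      · exact h
      · subst h; exact absurd hi (not_lt.2 hj.le)
      · exact absurd (hlt j h) hj.ne'
    have := ha j (hj.trans_le (hg' j))
    simp only [activeElements, Finset.mem_filter, Finset.mem_univ, true_and] at this
    exact this i hij hmem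
  rcases lt_trichotomy (toLex f₁) (toLex f₂) with h | h | h
  · exact absurd h (key f₂ h₂ f₁ h₁ hg₁ ha₂)
  · exact h
  · exact absurd h (key f₁ h₁ f₂ h₂ hg₂ ha₁)

theorem upperShift_finite_ncard (hB : HasExchange B) {m : ℤ} (hm : ∀ f ∈ B, ∑ s, f s = m)
    (k : ℕ) :
    (upperShift B k).Finite ∧ (upperShift B k).ncard =
      ∑ f ∈ B, ((activeElements B o f).card + k - 1).choose k := by
  classical
  let φ : (Σ _ : S → ℤ, S → ℕ) → S → ℤ := fun p s => p.1 s + (p.2 s : ℤ)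
  let D : Finset (Σ _ : S → ℤ, S → ℕ) :=
    B.sigma fun f => Finset.piAntidiag (activeElements B o f) k
  have hD : ∀ p ∈ D, p.1 ∈ B ∧ p.1 ≤ φ p ∧
      ∀ s, p.1 s < φ p s → s ∈ activeElements B o p.1 := by
    rintro ⟨f, h⟩ hp
    simp only [D, Finset.mem_sigma, Finset.mem_piAntidiag] at hp
    refine ⟨hp.1, fun s => by simp [φ], fun s hs => hp.2.2 s ?_⟩
    rintro h0
    simp [φ, h0] at hs
  have hinj : Set.InjOn φ D := by
    rintro ⟨f, h⟩ hp ⟨f', h'⟩ hp' heq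
    obtain ⟨a, b, c⟩ := hD _ hp
    obtain ⟨a', b', c'⟩ := hD _ hp'
    rw [← heq] at b' c'
    obtain rfl : f = f' := eq_of_sub_supported_on_activeElements o hB a a' b b' c c'
    have : h = h' := by
      funext s
      have := congrFun heq s
      simpa [φ] using this
    rw [this]
  have heq : upperShift B k = (D.image φ : Finset (S → ℤ)) := by
    ext g
    simp only [Finset.coe_image, Set.mem_image, Finset.mem_coe]
    constructor
    · rintro ⟨f₀, hf₀, h₀, hs₀, rfl⟩
      obtain ⟨f, hf, hle, hact⟩ := exists_sub_supported_on_activeElements (B := B) o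
        (g := fun s => f₀ s + (h₀ s : ℤ)) hf₀ (fun s => by simp)
      have hle' : ∀ s, f s ≤ f₀ s + (h₀ s : ℤ) := hle
      have hh : ∀ s, (((f₀ s + (h₀ s : ℤ) - f s).toNat : ℕ) : ℤ) = f₀ s + (h₀ s : ℤ) - f s :=
        fun s => Int.toNat_of_nonneg (sub_nonneg.2 (hle' s))
      have hsupp : ∀ s, (f₀ s + (h₀ s : ℤ) - f s).toNat ≠ 0 → s ∈ activeElements B o f := by
        intro s hs
        refine hact s ?_
        omega
      refine ⟨⟨f, fun s => (f₀ s + (h₀ s : ℤ) - f s).toNat⟩, ?_, ?_⟩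
      · simp only [D, Finset.mem_sigma, Finset.mem_piAntidiag]
        refine ⟨hf, ?_, hsupp⟩
        rw [Finset.sum_subset (Finset.subset_univ (activeElements B o f))
          fun s _ hs => not_not.1 (mt (hsupp s) hs)]
        -- All elements of `B` have the same total, so replacing `f₀` by `f` keeps the total of the
        -- difference equal to `k`.
        zify
        simp only [hh, Finset.sum_sub_distrib, Finset.sum_add_distrib, hm f₀ hf₀, hm f hf,
          ← hs₀, Nat.cast_sum]
        ring
      · funext s
        simp only [φ, hh]
        ring
    · rintro ⟨⟨f, h⟩, hp, rfl⟩
      simp only [D, Finset.mem_sigma, Finset.mem_piAntidiag] at hp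
      refine ⟨f, hp.1, h, ?_, rfl⟩
      rw [← hp.2.1]
      refine (Finset.sum_subset (Finset.subset_univ _) fun s _ hs => ?_).symm
      by_contra h0
      exact hs (hp.2.2 s h0)
  rw [heq]
  refine ⟨Finset.finite_toSet _, ?_⟩
  rw [Set.ncard_coe_finset, Finset.card_image_of_injOn hinj, Finset.card_sigma]
  simp [card_piAntidiag_nat]

end

/-! ### Tight sets and the exchange property of integer bases -/

theorem mem_integerBases {S : Type*} [Fintype S] {μ : Finset S → ℤ} {f : S → ℤ} :
    f ∈ integerBases μ ↔
      (∀ s, 0 ≤ f s) ∧ (∀ U : Finset S, ∑ s ∈ U, f s ≤ μ U) ∧ ∑ s, f s = μ Finset.univ := by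
  simp only [integerBases, latticePoints, basePolytope, polymatroid, Set.Finite.mem_toFinset,
    Set.mem_ofPred_eq, and_assoc]
  norm_cast

section

variable {S : Type*} [DecidableEq S] {μ : Finset S → ℤ}

/-- Tight sets are closed under unions and intersections. -/
theorem tight_union_inter (hsub : ∀ A B : Finset S, μ (A ∪ B) + μ (A ∩ B) ≤ μ A + μ B)
    {f : S → ℤ} (hf : ∀ U : Finset S, ∑ s ∈ U, f s ≤ μ U) {A B : Finset S}
    (hA : ∑ s ∈ A, f s = μ A) (hB : ∑ s ∈ B, f s = μ B) :
    ∑ s ∈ A ∪ B, f s = μ (A ∪ B) ∧ ∑ s ∈ A ∩ B, f s = μ (A ∩ B) := by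
  have h := Finset.sum_union_inter (s₁ := A) (s₂ := B) (f := f)
  have h1 := hf (A ∪ B)
  have h2 := hf (A ∩ B)
  have h3 := hsub A B
  constructor <;> linarith

/-- If every element of `E` lies in a tight set contained in `V`, then `E` is contained in a
set inside `V` which is tight or empty. -/
theorem exists_tight_or_empty_superset
    (hsub : ∀ A B : Finset S, μ (A ∪ B) + μ (A ∩ B) ≤ μ A + μ B)
    {f : S → ℤ} (hf : ∀ U : Finset S, ∑ s ∈ U, f s ≤ μ U) (V : Set S) (E : Finset S)
    (hE : ∀ e ∈ E, ∃ T : Finset S, e ∈ T ∧ ↑T ⊆ V ∧ ∑ s ∈ T, f s = μ T) :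
    ∃ T : Finset S, E ⊆ T ∧ ↑T ⊆ V ∧ (∑ s ∈ T, f s = μ T ∨ T = ∅) := by
  induction E using Finset.induction_on with
  -- `μ ∅ = 0` is not assumed, so the empty set need not be tight.
  | empty => exact ⟨∅, by simp⟩
  | insert e E _ ih =>
    obtain ⟨T, hET, hTV, hT⟩ := ih fun x hx => hE x (Finset.mem_insert_of_mem hx)
    obtain ⟨T', heT, hTV', hT'⟩ := hE e (Finset.mem_insert_self _ _)
    rcases hT with hT | rfl
    · refine ⟨T ∪ T', ?_, ?_, Or.inl (tight_union_inter hsub hf hT hT').1⟩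
      · intro x hx
        rcases Finset.mem_insert.1 hx with rfl | hx
        · exact Finset.mem_union_right _ heT
        · exact Finset.mem_union_left _ (hET hx)
      · simp [hTV, hTV']
    · refine ⟨T', ?_, hTV', Or.inl hT'⟩
      rw [Finset.subset_empty.1 hET]
      simpa using heT

/-- If every element of `E` is avoided by a tight set containing `i`, then `E` is disjoint from
a tight set containing `i`. -/
theorem exists_tight_disjoint [Fintype S]
    (hsub : ∀ A B : Finset S, μ (A ∪ B) + μ (A ∩ B) ≤ μ A + μ B)
    {f : S → ℤ} (hf : ∀ U : Finset S, ∑ s ∈ U, f s ≤ μ U) (hS : ∑ s, f s = μ Finset.univ)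
    (i : S) (E : Finset S)
    (hE : ∀ e ∈ E, ∃ T : Finset S, i ∈ T ∧ e ∉ T ∧ ∑ s ∈ T, f s = μ T) :
    ∃ T : Finset S, i ∈ T ∧ (∀ e ∈ E, e ∉ T) ∧ ∑ s ∈ T, f s = μ T := by
  induction E using Finset.induction_on with
  | empty => exact ⟨Finset.univ, by simp [hS]⟩
  | insert e E _ ih =>
    obtain ⟨T, hi, hET, hT⟩ := ih fun x hx => hE x (Finset.mem_insert_of_mem hx)
    obtain ⟨T', hi', heT, hT'⟩ := hE e (Finset.mem_insert_self _ _)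
    refine ⟨T ∩ T', by simp [hi, hi'], ?_, (tight_union_inter hsub hf hT hT').2⟩
    intro x hx
    rcases Finset.mem_insert.1 hx with rfl | hx
    · simp [heT]
    · simp [hET x hx]

theorem sum_transfer (f : S → ℤ) (i j : S) (U : Finset S) :
    ∑ s ∈ U, transfer f i j s =
      ∑ s ∈ U, f s - (if i ∈ U then 1 else 0) + (if j ∈ U then 1 else 0) := by
  simp [transfer_apply, Finset.sum_add_distrib]

end

section

variable {S : Type*} [Fintype S] [DecidableEq S] {μ : Finset S → ℤ}

/-- For monotone `μ`, nonnegativity is a consequence of the other conditions on bases. -/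
theorem mem_integerBases_of_monotone (hmono : ∀ A B : Finset S, A ⊆ B → μ A ≤ μ B)
    {f : S → ℤ} (hU : ∀ U : Finset S, ∑ s ∈ U, f s ≤ μ U) (hS : ∑ s, f s = μ Finset.univ) :
    f ∈ integerBases μ := by
  refine mem_integerBases.2 ⟨fun s => ?_, hU, hS⟩
  have h1 := hU (Finset.univ.erase s)
  have h2 := hmono (Finset.univ.erase s) Finset.univ (Finset.subset_univ _)
  have h3 := Finset.add_sum_erase Finset.univ f (Finset.mem_univ s)
  linarith

/-- A transfer out of the set of bases is obstructed by a tight set. -/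
theorem exists_tight_of_transfer_notMem (hmono : ∀ A B : Finset S, A ⊆ B → μ A ≤ μ B)
    {f : S → ℤ} (hf : f ∈ integerBases μ) {i j : S} (h : transfer f i j ∉ integerBases μ) :
    ∃ T : Finset S, j ∈ T ∧ i ∉ T ∧ ∑ s ∈ T, f s = μ T := by
  obtain ⟨-, hU, hS⟩ := mem_integerBases.1 hf
  by_contra hcon
  push Not at hcon
  refine h (mem_integerBases_of_monotone hmono (fun U => ?_) (by simp [sum_transfer, hS]))
  have h1 := hU U
  have h2 := hcon U
  rw [sum_transfer]
  -- Only sets containing `j` but not `i` gain, and they gain exactly `1`; by integrality a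
  -- non-tight set has room for it.
  by_cases hj : j ∈ U <;> by_cases hi : i ∈ U <;> simp only [hi, hj, if_true, if_false] <;> try omega
  have := h2 hj hi
  omega

/-- Otherwise a union of tight sets of `f` avoids `i` and covers every `j` with `f j < g j`. On it
`g` has total at most that of `f`; off it `g ≤ f`, strictly at `i`. This contradicts the equal
totals. -/
theorem hasExchange_integerBases
    (hsub : ∀ A B : Finset S, μ (A ∪ B) + μ (A ∩ B) ≤ μ A + μ B)
    (hmono : ∀ A B : Finset S, A ⊆ B → μ A ≤ μ B) : HasExchange (integerBases μ) := by
  intro f hf g hg i hi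
  by_contra hcon
  push Not at hcon
  obtain ⟨-, hfU, hfS⟩ := mem_integerBases.1 hf
  obtain ⟨-, hgU, hgS⟩ := mem_integerBases.1 hg
  obtain ⟨T, hET, hTV, hT⟩ := exists_tight_or_empty_superset hsub hfU {i}ᶜ
    (Finset.univ.filter fun j => f j < g j) (by
      intro e he
      obtain ⟨T, h1, h2, h3⟩ := exists_tight_of_transfer_notMem hmono hf
        (hcon e (Finset.mem_filter.1 he).2)
      exact ⟨T, h1, by simpa using h2, h3⟩)
  have h1 : ∑ s ∈ T, g s ≤ ∑ s ∈ T, f s := by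
    rcases hT with hT | rfl
    · exact hT ▸ hgU T
    · simp
  have h2 : ∑ s ∈ Tᶜ, g s < ∑ s ∈ Tᶜ, f s := by
    refine Finset.sum_lt_sum (fun s hs => ?_) ⟨i, by simpa using hTV, hi⟩
    by_contra hlt
    exact Finset.mem_compl.1 hs (hET (by simpa using hlt))
  have h3 := Finset.sum_add_sum_compl T f
  have h4 := Finset.sum_add_sum_compl T g
  linarith

/-- Dually, an intersection of tight sets of `f` contains `i` and avoids every `j` with `g j < f j`;
there `g` has larger total than `f`, hence exceeds `μ`. -/
theorem hasExchange_neg_integerBases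
    (hsub : ∀ A B : Finset S, μ (A ∪ B) + μ (A ∩ B) ≤ μ A + μ B)
    (hmono : ∀ A B : Finset S, A ⊆ B → μ A ≤ μ B) : HasExchange (-integerBases μ) := by
  intro f' hf' g' hg' i hi'
  obtain ⟨f, hf, rfl⟩ := Finset.mem_neg.1 hf'
  obtain ⟨g, hg, rfl⟩ := Finset.mem_neg.1 hg'
  have hi : f i < g i := by simpa using hi'
  by_contra hcon
  have hcon : ∀ j, g j < f j → transfer f j i ∉ integerBases μ := by
    intro j hj hmem
    refine hcon ⟨j, by simpa using hj, Finset.mem_neg.2 ⟨_, hmem, ?_⟩⟩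
    simp only [transfer]; abel
  obtain ⟨-, hfU, hfS⟩ := mem_integerBases.1 hf
  obtain ⟨-, hgU, hgS⟩ := mem_integerBases.1 hg
  obtain ⟨T, hiT, hET, hT⟩ := exists_tight_disjoint hsub hfU hfS i
    (Finset.univ.filter fun j => g j < f j) fun e he =>
      exists_tight_of_transfer_notMem hmono hf (hcon e (Finset.mem_filter.1 he).2)
  have h1 : ∑ s ∈ T, f s < ∑ s ∈ T, g s := by
    refine Finset.sum_lt_sum (fun s hs => ?_) ⟨i, hiT, hi⟩
    by_contra hlt
    exact hET s (by simpa using hlt) hs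
  have := hgU T
  linarith

/-! ### Lattice points of the Minkowski sums -/

/-- A real base between two integer vectors can be replaced by an integer base. -/
theorem exists_integerBase_between
    (hsub : ∀ A B : Finset S, μ (A ∪ B) + μ (A ∩ B) ≤ μ A + μ B)
    (hmono : ∀ A B : Finset S, A ⊆ B → μ A ≤ μ B) {b : S → ℝ} (hb : b ∈ basePolytope μ)
    {l c : S → ℤ} (hl : ∀ s, (l s : ℝ) ≤ b s) (hc : ∀ s, b s ≤ c s) :
    ∃ f ∈ integerBases μ, l ≤ f ∧ f ≤ c := by
  classical
  obtain ⟨⟨-, hbU⟩, hbS⟩ := hb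
  have hlc : l ≤ c := fun s => by exact_mod_cast (hl s).trans (hc s)
  have hlU : ∀ U : Finset S, ∑ s ∈ U, l s ≤ μ U := fun U => by
    have := (Finset.sum_le_sum fun s (_ : s ∈ U) => hl s).trans (hbU U)
    exact_mod_cast this
  obtain ⟨f, hf, hmax⟩ := Finset.exists_max_image
    ((Finset.Icc l c).filter fun f => ∀ U : Finset S, ∑ s ∈ U, f s ≤ μ U) (fun f => ∑ s, f s)
    ⟨l, by simp [hlc, hlU]⟩
  simp only [Finset.mem_filter, Finset.mem_Icc] at hf hmax
  obtain ⟨⟨hlf, hfc⟩, hfU⟩ := hf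
  -- By maximality of the total, each coordinate below its cap `c` lies in a tight set. Comparing
  -- `b` with `f` on the union `T` (tight) and off it (`f = c`) shows that `f` has full total.
  obtain ⟨T, hET, -, hT⟩ := exists_tight_or_empty_superset hsub hfU Set.univ
    (Finset.univ.filter fun j => f j < c j) (by
      intro e he
      have he : f e < c e := (Finset.mem_filter.1 he).2
      by_contra hcon
      push Not at hcon
      have hsum : ∀ U : Finset S, ∑ s ∈ U, (f + Pi.single e 1 : S → ℤ) s =
          ∑ s ∈ U, f s + if e ∈ U then 1 else 0 := by
        intro U
        simp [Finset.sum_add_distrib, Pi.single_apply]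
      have := hmax (f + Pi.single e 1) ⟨⟨?_, ?_⟩, ?_⟩
      · rw [hsum] at this
        simp at this
      · refine hlf.trans ?_
        simp
      · intro s
        by_cases hs : s = e
        · subst hs; simpa using he
        · simpa [hs] using hfc s
      · intro U
        rw [hsum]
        have h1 := hfU U
        split_ifs with heU
        · have h2 := hcon U heU (Set.subset_univ _)
          omega
        · omega)
  have h1 : ∑ s ∈ T, b s ≤ ∑ s ∈ T, (f s : ℝ) := by
    rcases hT with hT | rfl
    · have : ∑ s ∈ T, (f s : ℝ) = μ T := by exact_mod_cast hT
      exact this ▸ hbU T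
    · simp
  have h2 : ∑ s ∈ Tᶜ, b s ≤ ∑ s ∈ Tᶜ, (f s : ℝ) := by
    refine Finset.sum_le_sum fun s hs => (hc s).trans ?_
    by_contra hlt
    exact Finset.mem_compl.1 hs (hET (by simpa using hlt))
  have h3 := Finset.sum_add_sum_compl T b
  have h4 := Finset.sum_add_sum_compl T fun s => (f s : ℝ)
  have h5 : (μ Finset.univ : ℝ) ≤ ∑ s, (f s : ℝ) := by linarith
  exact ⟨f, mem_integerBases_of_monotone hmono hfU
    (le_antisymm (hfU _) (by exact_mod_cast h5)), hlf, hfc⟩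

theorem mem_smul_stdSimplex [Nonempty S] {k : ℕ} {y : S → ℝ} :
    y ∈ (k : ℝ) • stdSimplex ℝ S ↔ (∀ s, 0 ≤ y s) ∧ ∑ s, y s = k := by
  constructor
  · rintro ⟨x, ⟨hx, hx1⟩, rfl⟩
    refine ⟨fun s => mul_nonneg (Nat.cast_nonneg k) (hx s), ?_⟩
    simp [← Finset.mul_sum, hx1]
  · rintro ⟨hy, hy1⟩
    -- For `k = 0` a vertex of the simplex is needed, since `0 • ∅` would be empty.
    rcases Nat.eq_zero_or_pos k with rfl | hk
    · obtain rfl : y = 0 := by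
        funext s
        exact (Finset.sum_eq_zero_iff_of_nonneg fun s _ => hy s).1 (by simpa using hy1) s
          (Finset.mem_univ s)
      exact ⟨Pi.single (Classical.arbitrary S) 1, single_mem_stdSimplex ℝ _, by simp⟩
    · have hk' : (k : ℝ) ≠ 0 := by positivity
      refine ⟨(k : ℝ)⁻¹ • y, ⟨fun s => ?_, ?_⟩, smul_inv_smul₀ hk' y⟩
      · exact mul_nonneg (by positivity) (hy s)
      · simp [← Finset.mul_sum, hy1, hk']

theorem invertedSimplex_eq_neg : invertedSimplex S = -stdSimplex ℝ S := by
  rw [invertedSimplex, ← convexHull_rangle_single_eq_stdSimplex, ← convexHull_neg]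
  congr 1
  ext x
  simp [neg_eq_iff_eq_neg, eq_neg_iff_add_eq_zero, add_comm]

theorem latticePoints_add_smul_stdSimplex [Nonempty S]
    (hsub : ∀ A B : Finset S, μ (A ∪ B) + μ (A ∩ B) ≤ μ A + μ B)
    (hmono : ∀ A B : Finset S, A ⊆ B → μ A ≤ μ B) (k : ℕ) :
    latticePoints (basePolytope μ + (k : ℝ) • stdSimplex ℝ S) =
      upperShift (integerBases μ) k := by
  ext g
  constructor
  · rintro ⟨b, hb, y, hy, hg⟩
    obtain ⟨hy, hy1⟩ := mem_smul_stdSimplex.1 hy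
    have hg : ∀ s, b s + y s = g s := congrFun hg
    obtain ⟨f, hf, -, hfg⟩ := exists_integerBase_between hsub hmono hb (l := 0) (c := g)
      (fun s => by simpa using hb.1.1 s) (fun s => by linarith [hg s, hy s])
    have hh : ∀ s, (((g s - f s).toNat : ℕ) : ℤ) = g s - f s :=
      fun s => Int.toNat_of_nonneg (sub_nonneg.2 (hfg s))
    refine ⟨f, hf, fun s => (g s - f s).toNat, ?_, by funext s; simp only [hh]; ring⟩
    zify
    simp only [hh, Finset.sum_sub_distrib, (mem_integerBases.1 hf).2.2]
    have : ∑ s, (g s : ℝ) = μ Finset.univ + k := by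
      rw [← hb.2, ← hy1, ← Finset.sum_add_distrib]
      exact Finset.sum_congr rfl fun s _ => (hg s).symm
    have : ∑ s, g s = μ Finset.univ + k := by exact_mod_cast this
    linarith
  · rintro ⟨f, hf, h, hs, rfl⟩
    refine ⟨fun s => (f s : ℝ), (latticePoints_basePolytope_finite μ).mem_toFinset.1 hf, fun s => (h s : ℝ),
      mem_smul_stdSimplex.2 ⟨fun s => by positivity, by exact_mod_cast hs⟩, ?_⟩
    funext s
    simp

theorem latticePoints_add_smul_invertedSimplex [Nonempty S]
    (hsub : ∀ A B : Finset S, μ (A ∪ B) + μ (A ∩ B) ≤ μ A + μ B)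
    (hmono : ∀ A B : Finset S, A ⊆ B → μ A ≤ μ B) (k : ℕ) :
    latticePoints (basePolytope μ + (k : ℝ) • invertedSimplex S) =
      -upperShift (-integerBases μ) k := by
  rw [invertedSimplex_eq_neg, Set.smul_set_neg]
  ext g
  constructor
  · rintro ⟨b, hb, y, hy, hg⟩
    obtain ⟨hy, hy1⟩ := mem_smul_stdSimplex.1 (Set.mem_neg.1 hy)
    simp only [Pi.neg_apply, Finset.sum_neg_distrib] at hy hy1
    have hg : ∀ s, b s + y s = g s := congrFun hg
    obtain ⟨f, hf, hfg, -⟩ := exists_integerBase_between hsub hmono hb (l := g)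
      -- Only the lower bound `g` matters; this `c` is an upper bound valid for every base.
      (c := fun s => μ {s}) (fun s => by linarith [hg s, hy s])
      (fun s => by simpa using hb.1.2 {s})
    have hh : ∀ s, (((f s - g s).toNat : ℕ) : ℤ) = f s - g s :=
      fun s => Int.toNat_of_nonneg (sub_nonneg.2 (hfg s))
    refine ⟨-f, Finset.mem_neg.2 ⟨f, hf, rfl⟩, fun s => (f s - g s).toNat, ?_,
      by funext s; simp only [hh, Pi.neg_apply]; ring⟩
    zify
    simp only [hh, Finset.sum_sub_distrib, (mem_integerBases.1 hf).2.2]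
    have : ∑ s, (g s : ℝ) = μ Finset.univ - k := by
      rw [← hb.2, ← hy1, sub_neg_eq_add, ← Finset.sum_add_distrib]
      exact Finset.sum_congr rfl fun s _ => (hg s).symm
    have : ∑ s, g s = μ Finset.univ - k := by exact_mod_cast this
    linarith
  · rintro ⟨f', hf', h, hs, hg⟩
    obtain ⟨f, hf, rfl⟩ := Finset.mem_neg.1 hf'
    refine ⟨fun s => (f s : ℝ), (latticePoints_basePolytope_finite μ).mem_toFinset.1 hf, fun s => -(h s : ℝ),
      Set.mem_neg.2 (mem_smul_stdSimplex.2 ⟨fun s => by simp, ?_⟩), ?_⟩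
    · simp only [Pi.neg_apply, neg_neg]
      exact_mod_cast hs
    · funext s
      have := congrFun hg s
      simp only [Pi.neg_apply] at this
      have : g s = f s - h s := by linarith
      simp [this, sub_eq_add_neg]

end

/-! ### Coefficients in the binomial basis -/

section

theorem binomPoly_degree (d : ℕ) : (binomPoly d).degree = d := by
  have h : (binomPoly d).natDegree = d := natDegree_preHilbertPoly ℚ d 0
  have h0 : binomPoly d ≠ 0 := by
    intro h0
    have := binomPoly_eval d 0
    simp [h0] at this
  rw [degree_eq_natDegree h0, h]

/-- Coefficients with respect to the binomial basis are unique. -/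
theorem binomPoly_combination_injective (n : ℕ) :
    Function.Injective fun a : Fin n → ℚ => ∑ i, C (a i) * binomPoly (n - 1 - (i : ℕ)) := by
  have hli := (⟨binomPoly, binomPoly_degree⟩ : Polynomial.Sequence ℚ).linearIndependent
  have hinj : Function.Injective fun i : Fin n => n - 1 - (i : ℕ) := by
    intro i j hij
    have := i.2
    have := j.2
    ext
    simp only at hij
    omega
  have h := Fintype.linearIndependent_iff.1 (hli.comp _ hinj)
  intro a b hab
  funext i
  refine sub_eq_zero.1 (h (fun i => a i - b i) ?_ i)
  have hab : ∑ i, C (a i) * binomPoly (n - 1 - (i : ℕ)) =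
    ∑ i, C (b i) * binomPoly (n - 1 - (i : ℕ)) := hab
  rw [← sub_eq_zero, ← Finset.sum_sub_distrib] at hab
  rw [← hab]
  refine Finset.sum_congr rfl fun i _ => ?_
  rw [smul_eq_C_mul, C_sub, sub_mul]
  rfl

theorem sum_binomPoly_eq {ι : Type*} (B : Finset ι) (w : ι → ℕ) {n : ℕ} (hw : ∀ f ∈ B, w f < n) :
    ∑ f ∈ B, binomPoly (n - 1 - w f) =
      ∑ i : Fin n, C (((∑ f ∈ B, X ^ w f : ℤ[X]).coeff (i : ℕ) : ℤ) : ℚ) *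
        binomPoly (n - 1 - (i : ℕ)) := by
  have h : ∀ i : Fin n, C (((∑ f ∈ B, X ^ w f : ℤ[X]).coeff (i : ℕ) : ℤ) : ℚ) *
      binomPoly (n - 1 - (i : ℕ)) =
      ∑ f ∈ B, if (i : ℕ) = w f then binomPoly (n - 1 - (i : ℕ)) else 0 := by
    intro i
    simp only [finsetSum_coeff, coeff_X_pow, Int.cast_sum, map_sum, Finset.sum_mul]
    refine Finset.sum_congr rfl fun f _ => ?_
    split_ifs <;> simp
  simp only [h]
  rw [Finset.sum_comm]
  refine Finset.sum_congr rfl fun f hf => ?_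
  rw [Finset.sum_eq_single (⟨w f, hw f hf⟩ : Fin n)]
  · simp
  · intro i _ hi
    exact if_neg fun h => hi (Fin.ext h)
  · simp

theorem natDegree_sum_X_pow_le {ι : Type*} (B : Finset ι) (w : ι → ℕ) {n : ℕ}
    (hw : ∀ f ∈ B, w f < n) : (∑ f ∈ B, X ^ w f : ℤ[X]).natDegree ≤ n - 1 := by
  refine natDegree_sum_le_of_forall_le _ _ fun f hf => ?_
  rw [natDegree_X_pow]
  exact Nat.le_sub_one_of_lt (hw f hf)

/-- If a counting function is, for every choice of a parameter, given by a generating sum of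
binomials, then it is a polynomial whose binomial coefficients are those of the generating
polynomial. -/
theorem exists_polynomial_of_sum_choose {ι κ : Type*} [Nonempty κ] (B : Finset ι)
    (w : κ → ι → ℕ) {n : ℕ} (hn : 0 < n) (hw : ∀ o, ∀ f ∈ B, w o f < n) (N : ℕ → ℕ)
    (hN : ∀ o k, N k = ∑ f ∈ B, (n - w o f + k - 1).choose k) :
    ∃ P : ℚ[X], (∀ k : ℕ, P.eval (k : ℚ) = N k) ∧
      (∀ o, ∀ a : Fin n → ℚ, P = ∑ i, C (a i) * binomPoly (n - 1 - (i : ℕ)) ↔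
        ∀ i, a i = ((∑ f ∈ B, X ^ w o f : ℤ[X]).coeff (i : ℕ) : ℚ)) ∧
      ∀ o o', (∑ f ∈ B, X ^ w o f : ℤ[X]) = ∑ f ∈ B, X ^ w o' f := by
  have heval : ∀ o (k : ℕ), (∑ f ∈ B, binomPoly (n - 1 - w o f)).eval (k : ℚ) = N k := by
    intro o k
    rw [hN o k, eval_finsetSum, Nat.cast_sum]
    refine Finset.sum_congr rfl fun f hf => ?_
    have := hw o f hf
    rw [binomPoly_eval, ← Nat.choose_symm_add]
    congr 2
    omega
  obtain ⟨o₀⟩ := ‹Nonempty κ›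
  -- The polynomials for different parameters agree at all natural numbers.
  have hP : ∀ o, ∑ f ∈ B, binomPoly (n - 1 - w o₀ f) = ∑ f ∈ B, binomPoly (n - 1 - w o f) := by
    intro o
    refine eq_of_infinite_eval_eq _ _ ((Set.infinite_range_of_injective
      (Nat.cast_injective (R := ℚ))).mono ?_)
    rintro _ ⟨k, rfl⟩
    exact (heval o₀ k).trans (heval o k).symm
  have hcoeff : ∀ o, ∀ a : Fin n → ℚ,
      ∑ f ∈ B, binomPoly (n - 1 - w o₀ f) = ∑ i, C (a i) * binomPoly (n - 1 - (i : ℕ)) ↔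
        ∀ i, a i = ((∑ f ∈ B, X ^ w o f : ℤ[X]).coeff (i : ℕ) : ℚ) := by
    intro o a
    rw [hP o, sum_binomPoly_eq B (w o) (hw o), ← funext_iff, eq_comm]
    exact (binomPoly_combination_injective n).eq_iff
  refine ⟨_, heval o₀, hcoeff, fun o o' => ?_⟩
  ext i
  by_cases hi : i < n
  -- The coefficients computed with `o` also represent `P` for `o'`, so uniqueness identifies them.
  · have := (hcoeff o' _).1 ((hcoeff o _).2 fun _ => rfl) ⟨i, hi⟩
    exact_mod_cast this
  · rw [coeff_eq_zero_of_natDegree_lt, coeff_eq_zero_of_natDegree_lt]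
    · have := natDegree_sum_X_pow_le B (w o') (hw o')
      omega
    · have := natDegree_sum_X_pow_le B (w o) (hw o)
      omega

/-! ### Activities and inactivity numbers -/

variable {S : Type*} [Fintype S] [DecidableEq S] (μ : Finset S → ℤ) (o : LinearOrder S)

/-- The least element of `S` is vacuously active. This gives the degree bound and keeps `|S| - 1 -
w` from being truncated. -/
theorem card_activeElements_pos [Nonempty S] (B : Finset (S → ℤ)) (f : S → ℤ) :
    0 < (activeElements B o f).card := by
  let := o
  obtain ⟨m, -, hm⟩ := Finset.exists_min_image Finset.univ (id : S → S) Finset.univ_nonempty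
  refine Finset.card_pos.2 ⟨m, ?_⟩
  simp only [activeElements, Finset.mem_filter, Finset.mem_univ, true_and]
  exact fun e he => absurd (hm e (Finset.mem_univ e)) (not_le.2 he)

theorem card_activeElements_add_externalInactivity (f : S → ℤ) :
    (activeElements (integerBases μ) o f).card + externalInactivity μ o f = Fintype.card S := by
  classical
  rw [← Finset.card_univ, ← Finset.card_filter_add_card_filter_not (s := Finset.univ)
    (ExternallyActive μ o f)]
  simp only [activeElements, externalInactivity, ExternallyActive]
  congr 2
  ext
  simp [ExternallyActive]

theorem transfer_neg_mem_neg (B : Finset (S → ℤ)) (f : S → ℤ) (e e' : S) :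
    transfer (-f) e' e ∈ -B ↔ transfer f e e' ∈ B := by
  rw [Finset.mem_neg']
  have : -transfer (-f) e' e = transfer f e e' := by simp only [transfer]; abel
  rw [this]

/-- Negation reverses transfers, turning internal activity for `B` into external activity for `-B`.
-/
theorem card_activeElements_neg_add_internalInactivity (f : S → ℤ) :
    (activeElements (-integerBases μ) o (-f)).card + internalInactivity μ o f =
      Fintype.card S := by
  classical
  rw [← Finset.card_univ, ← Finset.card_filter_add_card_filter_not (s := Finset.univ)
    (InternallyActive μ o f)]
  simp only [activeElements, internalInactivity, InternallyActive, transfer_neg_mem_neg]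
  congr 2
  ext
  simp [InternallyActive]

end

theorem theorem2p5 {S : Type*} [Fintype S] [DecidableEq S] [Nonempty S] (μ : Finset S → ℤ)
    (hsub : ∀ A B : Finset S, μ (A ∪ B) + μ (A ∩ B) ≤ μ A + μ B)
    (hmono : ∀ A B : Finset S, A ⊆ B → μ A ≤ μ B) :
    ∃ P Q : ℚ[X],
      -- `P` and `Q` count the lattice points of `B_μ + k∇_S` and of `B_μ + kΔ_S`
      (∀ k : ℕ, (latticePoints (basePolytope μ + (k : ℝ) • invertedSimplex S)).Finite ∧
        P.eval (k : ℚ) =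
          ((latticePoints (basePolytope μ + (k : ℝ) • invertedSimplex S)).ncard : ℚ)) ∧
      (∀ k : ℕ, (latticePoints (basePolytope μ + (k : ℝ) • stdSimplex ℝ S)).Finite ∧
        Q.eval (k : ℚ) =
          ((latticePoints (basePolytope μ + (k : ℝ) • stdSimplex ℝ S)).ncard : ℚ)) ∧
      -- for every order, the coefficients of `P` and `Q` in the binomial basis exist, are unique,
      -- and are the coefficients of the interior and exterior polynomials in the standard basis
      (∀ o : LinearOrder S,
        (interiorPolynomial μ o).natDegree ≤ Fintype.card S - 1 ∧
        (exteriorPolynomial μ o).natDegree ≤ Fintype.card S - 1 ∧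
        (∀ a : Fin (Fintype.card S) → ℚ,
          P = ∑ i, C (a i) * binomPoly (Fintype.card S - 1 - (i : ℕ)) ↔
            ∀ i, a i = ((interiorPolynomial μ o).coeff (i : ℕ) : ℚ)) ∧
        (∀ a : Fin (Fintype.card S) → ℚ,
          Q = ∑ i, C (a i) * binomPoly (Fintype.card S - 1 - (i : ℕ)) ↔
            ∀ i, a i = ((exteriorPolynomial μ o).coeff (i : ℕ) : ℚ))) ∧
      -- independence of the order
      (∀ o o' : LinearOrder S,
        interiorPolynomial μ o = interiorPolynomial μ o' ∧
        exteriorPolynomial μ o = exteriorPolynomial μ o') := by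
  classical
  have hne : Nonempty (LinearOrder S) :=
    ⟨LinearOrder.lift' (Fintype.equivFin S) (Fintype.equivFin S).injective⟩
  have hint : ∀ (o : LinearOrder S), ∀ f ∈ integerBases μ,
      internalInactivity μ o f < Fintype.card S := fun o f _ => by
    have h1 := card_activeElements_neg_add_internalInactivity μ o f
    have h2 := card_activeElements_pos o (-integerBases μ) (-f)
    omega
  have hext : ∀ (o : LinearOrder S), ∀ f ∈ integerBases μ,
      externalInactivity μ o f < Fintype.card S := fun o f _ => by
    have h1 := card_activeElements_add_externalInactivity μ o f
    have h2 := card_activeElements_pos o (integerBases μ) f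
    omega
  have hcountN : ∀ (o : LinearOrder S) (k : ℕ),
      (latticePoints (basePolytope μ + (k : ℝ) • invertedSimplex S)).Finite ∧
      (latticePoints (basePolytope μ + (k : ℝ) • invertedSimplex S)).ncard =
        ∑ f ∈ integerBases μ,
          (Fintype.card S - internalInactivity μ o f + k - 1).choose k := by
    intro o k
    obtain ⟨h1, h2⟩ := upperShift_finite_ncard o (hasExchange_neg_integerBases hsub hmono)
      (m := -μ Finset.univ) (by
        intro f hf
        have := (mem_integerBases.1 (Finset.mem_neg'.1 hf)).2.2
        simp only [Pi.neg_apply, Finset.sum_neg_distrib] at this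
        linarith) k
    rw [latticePoints_add_smul_invertedSimplex hsub hmono]
    refine ⟨h1.neg, ?_⟩
    rw [Set.ncard_neg, h2, Finset.sum_neg_index]
    refine Finset.sum_congr rfl fun f _ => ?_
    rw [← card_activeElements_neg_add_internalInactivity μ o f, Nat.add_sub_cancel]
  have hcountD : ∀ (o : LinearOrder S) (k : ℕ),
      (latticePoints (basePolytope μ + (k : ℝ) • stdSimplex ℝ S)).Finite ∧
      (latticePoints (basePolytope μ + (k : ℝ) • stdSimplex ℝ S)).ncard =
        ∑ f ∈ integerBases μ,
          (Fintype.card S - externalInactivity μ o f + k - 1).choose k := by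
    intro o k
    obtain ⟨h1, h2⟩ := upperShift_finite_ncard o (hasExchange_integerBases hsub hmono)
      (fun f hf => (mem_integerBases.1 hf).2.2) k
    rw [latticePoints_add_smul_stdSimplex hsub hmono]
    refine ⟨h1, h2.trans (Finset.sum_congr rfl fun f _ => ?_)⟩
    rw [← card_activeElements_add_externalInactivity μ o f, Nat.add_sub_cancel]
  obtain ⟨P, hP, hPa, hPo⟩ := exists_polynomial_of_sum_choose (integerBases μ)
    (internalInactivity μ) Fintype.card_pos hint _ fun o k => (hcountN o k).2
  obtain ⟨Q, hQ, hQa, hQo⟩ := exists_polynomial_of_sum_choose (integerBases μ)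
    (externalInactivity μ) Fintype.card_pos hext _ fun o k => (hcountD o k).2
  exact ⟨P, Q, fun k => ⟨(hcountN hne.some k).1, hP k⟩, fun k => ⟨(hcountD hne.some k).1, hQ k⟩,
    fun o => ⟨natDegree_sum_X_pow_le _ _ (hint o), natDegree_sum_X_pow_le _ _ (hext o),
      hPa o, hQa o⟩, fun o o' => ⟨hPo o o', hQo o o'⟩⟩
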